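/- Let $k$ be a field and let $a\ge 1$ and $d\ge 2$ be integers. Write $a=dq+r$ with integers $q\ge 0$ and $0\le r\le d-1$. Let $H=\langle a,a+1,a+d\rangle=\{c_1a+c_2(a+1)+c_3(a+d)\mid c_1,c_2,c_3\in\mathbb Z_{\ge 0}\}$ and let $R=k[[H]]=k[[t^a,t^{a+1},t^{a+d}]]\subseteq k[[t]]$ be its numerical semigroup ring, that is, the ring of power series all of whose exponents lie in $H$, a one-dimensional local domain with maximal ideal $\mathfrak m$. Let $e_0(R),e_1(R)$ be the integers such that $$\ell_R(R/\mathfrak m^{n+1})=e_0(R)\binom{n+1}{1}-e_1(R)\qquad\text{for all sufficiently large } n.$$ Assume that $q+r\ge d-2$ and that $H$ is not symmetric; here $H$ is called symmetric if, with $F$ the largest integer not in $H$, for every integer $z$ exactly one of $z$ and $F-z$ belongs to $H$. Then: 1. if $1\le r\le d-2$, then $e_1(R)=\dfrac{a^2+d(d-2)a-r(d-1)(d-r)}{2d}$; 2. if $r=d-1$, then $e_1(R)=\dfrac{a^2+d(d-2)a-(d-1)^2}{2d}$. -/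

import Mathlib

open scoped PowerSeries

/-- A submonoid `H` of `ℕ` is *symmetric* if, `F` being the largest integer that is not in `H`
(the Frobenius number of `H`), exactly one of `z` and `F - z` lies in `H`, for every integer `z`. -/
def IsSymmetricSemigroup (H : AddSubmonoid ℕ) : Prop :=
  ∃ F : ℤ, IsGreatest {z : ℤ | ¬ ∃ h ∈ H, (h : ℤ) = z} F ∧
    ∀ z : ℤ, (∃ h ∈ H, (h : ℤ) = z) ↔ ¬ ∃ h ∈ H, (h : ℤ) = F - z

/-- The semigroup ring `k[[H]]`: the power series in one variable `t` over `k`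
all of whose exponents lie in `H`, as a subalgebra of `k[[t]]`. -/
def semigroupRing (k : Type*) [Field k] (H : AddSubmonoid ℕ) : Subalgebra k k⟦X⟧ where
  carrier := {f | ∀ n, n ∉ H → PowerSeries.coeff n f = 0}
  mul_mem' := by
    intro f g hf hg n hn
    rw [PowerSeries.coeff_mul]
    refine Finset.sum_eq_zero fun x hx => ?_
    rw [Finset.HasAntidiagonal.mem_antidiagonal] at hx
    by_cases h1 : x.1 ∈ H
    · have h2 : x.2 ∉ H := fun h2 => hn (hx ▸ H.add_mem h1 h2)
      rw [hg _ h2, mul_zero]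
    · rw [hf _ h1, zero_mul]
  add_mem' := by
    intro f g hf hg n hn
    rw [map_add, hf n hn, hg n hn, add_zero]
  algebraMap_mem' := by
    intro c n hn
    have h0 : n ≠ 0 := fun h => hn (h ▸ H.zero_mem)
    rw [PowerSeries.algebraMap_apply, PowerSeries.coeff_C, if_neg h0]

theorem semigroupRing_inv_mem (k : Type*) [Field k] (H : AddSubmonoid ℕ) (f : k⟦X⟧)
    (hf : f ∈ semigroupRing k H) : f⁻¹ ∈ semigroupRing k H := by
  intro n
  induction n using Nat.strong_induction_on with
  | _ n ih =>
    intro hn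
    have h0 : n ≠ 0 := fun h => hn (h ▸ H.zero_mem)
    rw [PowerSeries.coeff_inv, if_neg h0]
    refine mul_eq_zero_of_right _ (Finset.sum_eq_zero fun x hx => ?_)
    rw [Finset.HasAntidiagonal.mem_antidiagonal] at hx
    split_ifs with hlt
    · by_cases h1 : x.1 ∈ H
      · have h2 : x.2 ∉ H := fun h2 => hn (hx ▸ H.add_mem h1 h2)
        rw [ih _ hlt h2, mul_zero]
      · rw [hf _ h1, zero_mul]
    · rfl

/-- `k[[H]]` is a local ring. -/
instance semigroupRing_isLocalRing (k : Type*) [Field k] (H : AddSubmonoid ℕ) :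
    IsLocalRing (semigroupRing k H) := by
  have hloc : IsLocalHom ((semigroupRing k H).val : semigroupRing k H →+* k⟦X⟧) := by
    refine ⟨fun f hf => ?_⟩
    have hc : PowerSeries.constantCoeff (f : k⟦X⟧) ≠ 0 :=
      (PowerSeries.isUnit_iff_constantCoeff.mp hf).ne_zero
    refine IsUnit.of_mul_eq_one
      (⟨(f : k⟦X⟧)⁻¹, semigroupRing_inv_mem k H _ f.2⟩ : semigroupRing k H) ?_
    exact Subtype.ext (PowerSeries.mul_inv_cancel _ hc)
  exact RingHom.domain_isLocalRing ((semigroupRing k H).val : semigroupRing k H →+* k⟦X⟧)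

/-- `e₀` and `e₁` are the Hilbert coefficients of the (one-dimensional) local ring `A` with maximal
ideal `𝔪`: for all large `n`, the length of `A / 𝔪ⁿ⁺¹` is finite and
equal to `e₀ * (n + 1 choose 1) - e₁`. -/
def HasHilbertCoeffs (A : Type*) [CommRing A] [IsLocalRing A] (e₀ e₁ : ℤ) : Prop :=
  ∀ᶠ n : ℕ in Filter.atTop, ∃ l : ℕ,
    Module.length A (A ⧸ IsLocalRing.maximalIdeal A ^ (n + 1)) = (l : ℕ∞) ∧
      (l : ℤ) = e₀ * ((n + 1).choose 1 : ℤ) - e₁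

/-- The Hilbert coefficients are unique. -/
theorem HasHilbertCoeffs.unique {A : Type*} [CommRing A] [IsLocalRing A] {e₀ e₁ e₀' e₁' : ℤ}
    (h : HasHilbertCoeffs A e₀ e₁) (h' : HasHilbertCoeffs A e₀' e₁') : e₀ = e₀' ∧ e₁ = e₁' := by
  obtain ⟨N, hN⟩ := Filter.eventually_atTop.mp (h.and h')
  have key : ∀ n ≥ N, e₀ * ((n : ℤ) + 1) - e₁ = e₀' * ((n : ℤ) + 1) - e₁' := by
    intro n hn
    obtain ⟨⟨l, hl, h1⟩, ⟨l', hl', h2⟩⟩ := hN n hn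
    have : l = l' := by exact_mod_cast hl.symm.trans hl'
    subst this
    simp only [Nat.choose_one_right, Nat.cast_add, Nat.cast_one] at h1 h2
    linarith
  have k1 := key N le_rfl
  have k2 := key (N + 1) (Nat.le_succ N)
  push_cast at k2
  have e : e₀ = e₀' := by linarith
  subst e
  exact ⟨rfl, by linarith⟩

/-! For `N ≥ a`, `𝔪 ^ N` consists of all series of order at least `a * N`
(`semigroupRing.maximalIdeal_pow_eq`), so its colength is the number of elements of `H` below `a *
N` (`semigroupRing.colength_orderIdeal`). In the residue class of `i < a`, the least element of `H`
is `a * coinCount d i + i`; this is where `q + r ≥ d - 2` enters. Hence the count is `a * N - ∑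
coinCount d i`, so `e₀ = a` and `e₁` is the sum of the `coinCount d i`, the number of gaps of `H`.
Its closed form gives both cases. -/

/-- The colength of an ideal. -/
noncomputable def Ideal.colength {A : Type*} [CommRing A] (I : Ideal A) : ℕ∞ :=
  Module.length A (A ⧸ I)

theorem Ideal.colength_top {A : Type*} [CommRing A] : (⊤ : Ideal A).colength = 0 := by
  rw [Ideal.colength, Module.length_eq_zero_iff]
  exact Submodule.Quotient.subsingleton_iff.mpr rfl

/-- If `J = I + (x)` and `(I : x)` is the maximal ideal, then the colengths of `I` and `J`
differ by one. -/
theorem IsLocalRing.colength_eq_one_add {A : Type*} [CommRing A] [IsLocalRing A] {I J : Ideal A}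
    {x : A} (hle : I ≤ J) (hx : x ∈ J) (hxI : ∀ f, x * f ∈ I ↔ f ∈ IsLocalRing.maximalIdeal A)
    (hJ : ∀ f ∈ J, ∃ g, x * g - f ∈ I) : I.colength = 1 + J.colength := by
  let μ := LinearMap.mulLeft A x
  have hμ : IsLocalRing.maximalIdeal A = Submodule.comap μ I := by
    ext f
    exact (hxI f).symm
  let φ := Submodule.mapQ (IsLocalRing.maximalIdeal A) I μ hμ.le
  let ψ := Submodule.factor hle
  have hφ : Function.Injective φ := by
    rw [← LinearMap.ker_eq_bot, Submodule.ker_mapQ, ← hμ, Submodule.mkQ_map_self]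
  have hψ : Function.Surjective ψ := Submodule.factor_surjective hle
  have hex : Function.Exact φ ψ := by
    intro y
    obtain ⟨f, rfl⟩ := Submodule.mkQ_surjective _ y
    constructor
    · intro hf
      obtain ⟨g, hg⟩ := hJ f ((Submodule.Quotient.mk_eq_zero _).mp hf)
      exact ⟨Submodule.Quotient.mk g, (Submodule.Quotient.eq _).mpr hg⟩
    · rintro ⟨z, hz⟩
      obtain ⟨g, rfl⟩ := Submodule.mkQ_surjective _ z
      rw [← hz]
      exact (Submodule.Quotient.mk_eq_zero _).mpr (J.mul_mem_right g hx)
  rw [Ideal.colength, Ideal.colength, Module.length_eq_add_of_exact φ ψ hφ hψ hex]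
  congr 1
  rw [Module.length_eq_one_iff]
  exact isSimpleModule_iff_isCoatom.mpr (IsLocalRing.maximalIdeal.isMaximal A).out

/-! ### Order filtration of `k[[H]]` and powers of the maximal ideal -/

section SemigroupRing

variable (k : Type*) [Field k] (H : AddSubmonoid ℕ)

/-- The ideal of `k[[H]]` of the power series of order at least `c`. -/
def semigroupRing.orderIdeal (c : ℕ) : Ideal (semigroupRing k H) where
  carrier := {f | ∀ n < c, PowerSeries.coeff n (f : k⟦X⟧) = 0}
  add_mem' := by
    intro f g hf hg n hn
    simp [hf n hn, hg n hn]
  zero_mem' := by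
    intro n _
    simp
  smul_mem' := by
    intro f g hg n hn
    change PowerSeries.coeff n ((f : k⟦X⟧) * (g : k⟦X⟧)) = 0
    rw [PowerSeries.coeff_mul]
    refine Finset.sum_eq_zero fun x hx => ?_
    rw [Finset.HasAntidiagonal.mem_antidiagonal] at hx
    rw [hg x.2 (by omega), mul_zero]

variable {k H}

open semigroupRing

theorem semigroupRing.mem_orderIdeal {c : ℕ} {f : semigroupRing k H} :
    f ∈ orderIdeal k H c ↔ ∀ n < c, PowerSeries.coeff n (f : k⟦X⟧) = 0 := Iff.rfl

theorem semigroupRing.mem_orderIdeal_iff_dvd {c : ℕ} {f : semigroupRing k H} :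
    f ∈ orderIdeal k H c ↔ PowerSeries.X ^ c ∣ (f : k⟦X⟧) := by
  rw [mem_orderIdeal, PowerSeries.X_pow_dvd_iff]

variable (k) in
/-- The monomial `t ^ h` of `k[[H]]`, for `h ∈ H`. -/
noncomputable def semigroupRing.monomial {h : ℕ} (hh : h ∈ H) : semigroupRing k H :=
  ⟨PowerSeries.X ^ h, fun n hn => by
    rw [PowerSeries.coeff_X_pow, if_neg]
    rintro rfl
    exact hn hh⟩

theorem semigroupRing.orderIdeal_zero : orderIdeal k H 0 = ⊤ :=
  eq_top_iff.mpr fun _ _ n hn => absurd hn n.not_lt_zero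

theorem semigroupRing.orderIdeal_succ_of_notMem {c : ℕ} (hc : c ∉ H) :
    orderIdeal k H (c + 1) = orderIdeal k H c := by
  ext f
  refine ⟨fun hf n hn => hf n (by omega), fun hf n hn => ?_⟩
  rcases Nat.lt_succ_iff_lt_or_eq.mp hn with h | rfl
  · exact hf n h
  · exact f.2 n hc

theorem semigroupRing.mem_maximalIdeal {f : semigroupRing k H} :
    f ∈ IsLocalRing.maximalIdeal (semigroupRing k H) ↔ PowerSeries.coeff 0 (f : k⟦X⟧) = 0 := by
  rw [IsLocalRing.mem_maximalIdeal, mem_nonunits_iff, not_iff_comm,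
    PowerSeries.coeff_zero_eq_constantCoeff_apply]
  constructor
  · intro hc
    exact IsUnit.of_mul_eq_one
      (⟨(f : k⟦X⟧)⁻¹, semigroupRing_inv_mem k H _ f.2⟩ : semigroupRing k H)
      (Subtype.ext (PowerSeries.mul_inv_cancel _ hc))
  · intro hf
    exact (PowerSeries.isUnit_iff_constantCoeff.mp (hf.map (semigroupRing k H).val)).ne_zero

theorem semigroupRing.coeff_monomial_mul {c : ℕ} (hc : c ∈ H) (f : semigroupRing k H) (n : ℕ) :
    PowerSeries.coeff n ((monomial k hc * f : semigroupRing k H) : k⟦X⟧) =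
      if c ≤ n then PowerSeries.coeff (n - c) (f : k⟦X⟧) else 0 :=
  PowerSeries.coeff_X_pow_mul' _ _ _

theorem semigroupRing.monomial_mul_mem_orderIdeal_succ {c : ℕ} (hc : c ∈ H)
    {f : semigroupRing k H} :
    monomial k hc * f ∈ orderIdeal k H (c + 1) ↔
      f ∈ IsLocalRing.maximalIdeal (semigroupRing k H) := by
  rw [mem_maximalIdeal, mem_orderIdeal]
  constructor
  · intro h
    have h1 := h c (by omega)
    rwa [coeff_monomial_mul, if_pos le_rfl, Nat.sub_self] at h1
  · intro h n hn
    rw [coeff_monomial_mul]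
    split_ifs with hcn
    · rwa [show n - c = 0 by omega]
    · rfl

theorem semigroupRing.colength_orderIdeal_succ {c : ℕ} (hc : c ∈ H) :
    (orderIdeal k H (c + 1)).colength = 1 + (orderIdeal k H c).colength := by
  refine IsLocalRing.colength_eq_one_add (x := monomial k hc) (fun f hf n hn => hf n (by omega))
    (fun n hn => (PowerSeries.coeff_X_pow _ _).trans (if_neg hn.ne))
    (fun f => monomial_mul_mem_orderIdeal_succ hc) fun f hf => ?_
  refine ⟨algebraMap k _ (PowerSeries.coeff c (f : k⟦X⟧)), fun n hn => ?_⟩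
  change PowerSeries.coeff n (((monomial k hc * _ : semigroupRing k H) : k⟦X⟧) - (f : k⟦X⟧)) = 0
  rw [map_sub, coeff_monomial_mul, Subalgebra.coe_algebraMap, PowerSeries.algebraMap_apply,
    PowerSeries.coeff_C]
  rcases Nat.lt_succ_iff_lt_or_eq.mp hn with h | rfl
  · rw [if_neg (by omega), hf n h, sub_zero]
  · simp

/-- The length of `k[[H]]` modulo the series of order at least `c` is the number of elements
of `H` below `c`. -/
theorem semigroupRing.colength_orderIdeal [DecidablePred (· ∈ H)] (c : ℕ) :
    (orderIdeal k H c).colength =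
      ((∑ h ∈ Finset.range c, if h ∈ H then 1 else 0 : ℕ) : ℕ∞) := by
  induction c with
  | zero =>
    rw [orderIdeal_zero, Ideal.colength_top, Finset.sum_range_zero, Nat.cast_zero]
  | succ c ih =>
    rw [Finset.sum_range_succ]
    by_cases hc : c ∈ H
    · rw [colength_orderIdeal_succ hc, ih, if_pos hc, Nat.cast_add, Nat.cast_one, add_comm]
    · rw [orderIdeal_succ_of_notMem hc, ih, if_neg hc, add_zero]

theorem semigroupRing.maximalIdeal_pow_le {a : ℕ} (ha : ∀ h ∈ H, h ≠ 0 → a ≤ h) (N : ℕ) :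
    IsLocalRing.maximalIdeal (semigroupRing k H) ^ N ≤ orderIdeal k H (a * N) := by
  induction N with
  | zero => rw [mul_zero, orderIdeal_zero]; exact le_top
  | succ N ih =>
    rw [pow_succ, Ideal.mul_le]
    intro f hf g hg
    have hf' := mem_orderIdeal_iff_dvd.mp (ih hf)
    have hg' : PowerSeries.X ^ a ∣ (g : k⟦X⟧) := by
      rw [PowerSeries.X_pow_dvd_iff]
      intro m hm
      by_cases hmH : m ∈ H
      · have h0 : m = 0 := by
          by_contra h0
          exact absurd (ha m hmH h0) (by omega)
        rw [h0]
        exact mem_maximalIdeal.mp hg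
      · exact g.2 m hmH
    rw [mem_orderIdeal_iff_dvd, mul_add, mul_one, pow_add]
    exact mul_dvd_mul hf' hg'

theorem semigroupRing.monomial_mem_maximalIdeal {h : ℕ} (hh : h ∈ H) (h0 : h ≠ 0) :
    monomial k hh ∈ IsLocalRing.maximalIdeal (semigroupRing k H) := by
  rw [mem_maximalIdeal]
  exact PowerSeries.coeff_X_pow _ _ |>.trans (if_neg h0.symm)

/-- If `a` is the multiplicity of `H` and `a + 1 ∈ H`, the high powers of the maximal ideal
of `k[[H]]` are the ideals `t ^ (a * N) k[[t]]`. -/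
theorem semigroupRing.maximalIdeal_pow_eq {a : ℕ} (ha0 : 0 < a) (haH : a ∈ H) (haH' : a + 1 ∈ H)
    (ha : ∀ h ∈ H, h ≠ 0 → a ≤ h) {N : ℕ} (hN : a ≤ N) :
    IsLocalRing.maximalIdeal (semigroupRing k H) ^ N = orderIdeal k H (a * N) := by
  refine le_antisymm (maximalIdeal_pow_le ha N) fun f hf => ?_
  -- Split `f` by exponents modulo `a`: the part in the class of `a * N + i` is `t ^ (a * N + i)`
  -- times a series in `t ^ a`, and `t ^ (a * N + i) = (t ^ a) ^ (N - i) * (t ^ (a + 1)) ^ i`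
  -- because `i < a ≤ N`.
  let g : ℕ → semigroupRing k H := fun i =>
    ⟨PowerSeries.mk fun n =>
      if a ∣ n then PowerSeries.coeff (a * N + i + n) (f : k⟦X⟧) else 0, fun n hn => by
        rw [PowerSeries.coeff_mk, if_neg]
        rintro ⟨m, rfl⟩
        exact hn (by simpa [mul_comm] using H.nsmul_mem haH m)⟩
  have hfg : f = ∑ i ∈ Finset.range a,
      monomial k haH ^ (N - i) * monomial k haH' ^ i * g i := by
    refine Subtype.ext (PowerSeries.ext fun n => ?_)
    have hmon : ∀ i ∈ Finset.range a,
        PowerSeries.coeff n ((monomial k haH ^ (N - i) * monomial k haH' ^ i * g i :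
          semigroupRing k H) : k⟦X⟧) =
        if a * N + i ≤ n ∧ a ∣ n - (a * N + i) then PowerSeries.coeff n (f : k⟦X⟧) else 0 := by
      intro i hi
      rw [Finset.mem_range] at hi
      have hexp : a * (N - i) + (a + 1) * i = a * N + i := by
        obtain ⟨m, rfl⟩ := Nat.exists_eq_add_of_le (hi.le.trans hN)
        rw [Nat.add_sub_cancel_left]
        ring
      have hg : ∀ m, PowerSeries.coeff m (g i : k⟦X⟧) =
          if a ∣ m then PowerSeries.coeff (a * N + i + m) (f : k⟦X⟧) else 0 :=
        fun m => by simp only [g, PowerSeries.coeff_mk]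
      have hX : ((monomial k haH ^ (N - i) * monomial k haH' ^ i * g i : semigroupRing k H) :
          k⟦X⟧) = (PowerSeries.X ^ a) ^ (N - i) * (PowerSeries.X ^ (a + 1)) ^ i * (g i : k⟦X⟧) := by
        rw [Subalgebra.coe_mul, Subalgebra.coe_mul, Subalgebra.coe_pow, Subalgebra.coe_pow]
        rfl
      rw [hX, ← pow_mul, ← pow_mul, ← pow_add, hexp, PowerSeries.coeff_X_pow_mul', hg]
      by_cases h : a * N + i ≤ n
      · simp [h]
      · simp [h]
    rw [AddSubmonoidClass.coe_finsetSum, map_sum, Finset.sum_congr rfl hmon]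
    by_cases hn : n < a * N
    · rw [hf n hn, Finset.sum_eq_zero]
      intro i _
      rw [if_neg (by omega)]
    · obtain ⟨m, rfl⟩ := Nat.exists_eq_add_of_le (not_lt.mp hn)
      rw [Finset.sum_eq_single (m % a), if_pos]
      · refine ⟨Nat.add_le_add_left (Nat.mod_le m a) _, ?_⟩
        rw [Nat.add_sub_add_left]
        exact Nat.dvd_sub_mod m
      · intro i hi hne
        rw [Finset.mem_range] at hi
        refine if_neg ?_
        rintro ⟨h1, h2⟩
        rw [Nat.add_sub_add_left] at h2
        have h3 := (Nat.modEq_iff_dvd' (by omega)).mpr h2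
        rw [Nat.ModEq, Nat.mod_eq_of_lt hi] at h3
        exact hne h3
      · intro h
        exact absurd (Finset.mem_range.mpr (Nat.mod_lt m ha0)) h
  rw [hfg]
  refine Ideal.sum_mem _ fun i hi => Ideal.mul_mem_right _ _ ?_
  rw [Finset.mem_range] at hi
  rw [show N = (N - i) + i by omega, pow_add, Nat.add_sub_cancel]
  exact Ideal.mul_mem_mul
    (Ideal.pow_mem_pow (monomial_mem_maximalIdeal haH ha0.ne') _)
    (Ideal.pow_mem_pow (monomial_mem_maximalIdeal haH' a.succ_ne_zero) _)

end SemigroupRing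

/-! ### Apéry set and gap count of `⟨a, a + 1, a + d⟩` -/

section ThreeGenerated

/-- The least `c₂ + c₃` with `c₂ + d * c₃ = j`. -/
def coinCount (d j : ℕ) : ℕ := j / d + j % d

theorem coinCount_le (d x y : ℕ) (hd : 0 < d) : coinCount d (x + d * y) ≤ x + y := by
  rw [coinCount, Nat.add_mul_div_left _ _ hd, Nat.add_mul_mod_self_left]
  have h1 := Nat.div_add_mod x d
  have h2 := Nat.le_mul_of_pos_left (x / d) hd
  omega

theorem coinCount_mul_add {d v : ℕ} (u : ℕ) (hv : v < d) : coinCount d (d * u + v) = u + v := by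
  rw [coinCount, Nat.mul_add_div (by omega), Nat.div_eq_of_lt hv, Nat.mul_add_mod,
    Nat.mod_eq_of_lt hv, add_zero]

/-- Adding `d * q + r` changes the count by `q + r` if the remainders add without carry, and by `q +
r + 1 - d ≥ -1` if they carry. -/
theorem coinCount_le_add {d q r : ℕ} (hr : r < d) (hqr : d ≤ q + r + 2) (j : ℕ) :
    coinCount d j ≤ coinCount d (j + (d * q + r)) + 1 := by
  have hd : 0 < d := by omega
  have hv := Nat.mod_lt j hd
  rw [← Nat.div_add_mod j d]
  generalize j / d = u at *
  generalize j % d = v at *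
  rw [coinCount_mul_add u hv]
  by_cases h : v + r < d
  · rw [show d * u + v + (d * q + r) = d * (u + q) + (v + r) by ring, coinCount_mul_add _ h]
    omega
  · obtain ⟨w, hw⟩ := Nat.exists_eq_add_of_le (not_lt.mp h)
    rw [show d * u + v + (d * q + r) = d * (u + q + 1) + w by
      rw [show d * u + v + (d * q + r) = d * (u + q) + (v + r) by ring, hw]; ring,
      coinCount_mul_add _ (by omega)]
    omega

theorem coinCount_le_add_mul {d q r : ℕ} (hr : r < d) (hqr : d ≤ q + r + 2) (j m : ℕ) :
    coinCount d j ≤ coinCount d (j + (d * q + r) * m) + m := by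
  induction m with
  | zero => simp
  | succ m ih =>
    have h := coinCount_le_add hr hqr (j + (d * q + r) * m)
    rw [add_assoc, ← Nat.mul_succ] at h
    rw [← Nat.succ_eq_add_one]
    omega

theorem mem_closure_three_iff {x y z h : ℕ} :
    h ∈ AddSubmonoid.closure {x, y, z} ↔ ∃ c₁ c₂ c₃ : ℕ, c₁ * x + c₂ * y + c₃ * z = h := by
  rw [Set.insert_eq, AddSubmonoid.closure_union, AddSubmonoid.mem_sup]
  simp only [AddSubmonoid.mem_closure_singleton, AddSubmonoid.mem_closure_pair, smul_eq_mul]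
  constructor
  · rintro ⟨_, ⟨c₁, rfl⟩, _, ⟨c₂, c₃, rfl⟩, rfl⟩
    exact ⟨c₁, c₂, c₃, by ring⟩
  · rintro ⟨c₁, c₂, c₃, rfl⟩
    exact ⟨_, ⟨c₁, rfl⟩, _, ⟨c₂, c₃, rfl⟩, by ring⟩

/-- The Apéry set of `⟨a, a + 1, a + d⟩` with respect to `a`. -/
theorem mul_add_mem_closure_iff {a d q r : ℕ} (hdiv : a = d * q + r) (hr : r < d)
    (hqr : d ≤ q + r + 2) {s i : ℕ} (hi : i < a) :
    a * s + i ∈ AddSubmonoid.closure {a, a + 1, a + d} ↔ coinCount d i ≤ s := by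
  rw [mem_closure_three_iff]
  constructor
  · rintro ⟨c₁, c₂, c₃, hc⟩
    have hc' : a * (c₁ + c₂ + c₃) + (c₂ + d * c₃) = a * s + i := by rw [← hc]; ring
    -- If fewer than `s` generators are used, the deficit `m` forces `c₂ + d * c₃ = i + a * m`; each
    -- extra `a` lowers `coinCount` by at most one, so nothing is gained over `s`.
    have hle : c₁ + c₂ + c₃ ≤ s := by
      by_contra hlt
      have := Nat.mul_le_mul_left a (show s + 1 ≤ c₁ + c₂ + c₃ by omega)
      rw [mul_add, mul_one] at this
      omega
    obtain ⟨m, rfl⟩ := Nat.exists_eq_add_of_le hle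
    have hj : c₂ + d * c₃ = i + (d * q + r) * m := by
      rw [← hdiv]
      rw [mul_add a] at hc'
      linarith
    have h1 := coinCount_le d c₂ c₃ (by omega)
    have h2 := coinCount_le_add_mul hr hqr i m
    rw [hj] at h1
    omega
  · intro h
    obtain ⟨m, rfl⟩ := Nat.exists_eq_add_of_le h
    -- The optimal representation of `i`, padded with `m` copies of `a`.
    refine ⟨m, i % d, i / d, ?_⟩
    have hi' := Nat.div_add_mod i d
    rw [coinCount]
    linear_combination hi'

theorem two_mul_sum_coinCount (d q r : ℕ) (hr : r ≤ d) :
    2 * ((∑ i ∈ Finset.range (d * q + r), coinCount d i : ℕ) : ℤ) =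
      d * q ^ 2 + 2 * q * r + d * (d - 2) * q + r * (r - 1) := by
  -- The case `r = d` is allowed so that a full block carries `q` to `q + 1`.
  have step : ∀ q r : ℕ, r ≤ d →
      2 * ((∑ i ∈ Finset.range (d * q + r), coinCount d i : ℕ) : ℤ) =
        2 * ((∑ i ∈ Finset.range (d * q), coinCount d i : ℕ) : ℤ) + 2 * q * r + r * (r - 1) := by
    intro q r hr
    induction r with
    | zero => simp
    | succ r ih =>
      rw [← add_assoc, Finset.sum_range_succ, coinCount_mul_add q hr, Nat.cast_add, mul_add,
        ih (by omega)]
      push_cast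
      ring
  have base : ∀ q : ℕ, 2 * ((∑ i ∈ Finset.range (d * q), coinCount d i : ℕ) : ℤ) =
      d * q ^ 2 + d * (d - 2) * q := by
    intro q
    induction q with
    | zero => simp
    | succ q ih =>
      rw [mul_add, mul_one, step q d le_rfl, ih]
      push_cast
      ring
  rw [step q r hr, base]
  ring

theorem sum_range_ite_le (c N : ℕ) :
    ∑ s ∈ Finset.range N, (if c ≤ s then 1 else 0) = N - c := by
  rw [← Finset.sum_filter, Finset.sum_const, smul_eq_mul, mul_one,
    show (Finset.range N).filter (c ≤ ·) = Finset.Ico c N by ext; simp; omega, Nat.card_Ico]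

theorem sum_range_mul_eq (f : ℕ → ℕ) (a N : ℕ) :
    ∑ h ∈ Finset.range (a * N), f h =
      ∑ i ∈ Finset.range a, ∑ s ∈ Finset.range N, f (a * s + i) := by
  rw [Finset.sum_comm]
  induction N with
  | zero => simp
  | succ N ih => rw [mul_add, mul_one, Finset.sum_range_add, ih, Finset.sum_range_succ]

/-- The number of elements of `⟨a, a + 1, a + d⟩` below a large multiple of `a`. -/
theorem sum_range_mem_closure_add {a d q r : ℕ} (hdiv : a = d * q + r) (hr : r < d)
    (hqr : d ≤ q + r + 2) {N : ℕ} (hN : a ≤ N)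
    [DecidablePred (· ∈ AddSubmonoid.closure {a, a + 1, a + d})] :
    (∑ h ∈ Finset.range (a * N),
        if h ∈ AddSubmonoid.closure {a, a + 1, a + d} then 1 else 0) +
      ∑ i ∈ Finset.range a, coinCount d i = a * N := by
  rw [sum_range_mul_eq, ← Finset.sum_add_distrib]
  have : ∀ i ∈ Finset.range a, (∑ s ∈ Finset.range N,
      if a * s + i ∈ AddSubmonoid.closure {a, a + 1, a + d} then 1 else 0) + coinCount d i = N := by
    intro i hi
    rw [Finset.mem_range] at hi
    -- `coinCount d i ≤ i < a ≤ N` makes the truncated `N - coinCount d i` exact.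
    have hle : coinCount d i ≤ N := by
      have := coinCount_le d i 0 (by omega)
      rw [mul_zero, add_zero] at this
      omega
    simp only [mul_add_mem_closure_iff hdiv hr hqr hi]
    rw [sum_range_ite_le, Nat.sub_add_cancel hle]
  rw [Finset.sum_congr rfl this, Finset.sum_const, Finset.card_range, smul_eq_mul]

theorem hasHilbertCoeffs_semigroupRing_three (k : Type*) [Field k] {a d q r : ℕ} (ha : 0 < a)
    (hdiv : a = d * q + r) (hr : r < d) (hqr : d ≤ q + r + 2) :
    HasHilbertCoeffs (semigroupRing k (AddSubmonoid.closure {a, a + 1, a + d})) a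
      (∑ i ∈ Finset.range a, coinCount d i : ℕ) := by
  classical
  filter_upwards [Filter.eventually_ge_atTop a] with n hn
  have hmin : ∀ h ∈ AddSubmonoid.closure {a, a + 1, a + d}, h ≠ 0 → a ≤ h := by
    intro h hh h0
    by_contra hlt
    -- An element below `a` has `coinCount` zero, hence is zero.
    have := (mul_add_mem_closure_iff (s := 0) hdiv hr hqr (not_le.mp hlt)).mp (by simpa using hh)
    rw [coinCount, Nat.le_zero, Nat.add_eq_zero_iff] at this
    have h1 := Nat.div_add_mod h d
    rw [this.1, this.2] at h1
    omega
  refine ⟨∑ h ∈ Finset.range (a * (n + 1)),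
    if h ∈ AddSubmonoid.closure {a, a + 1, a + d} then 1 else 0, ?_, ?_⟩
  · rw [semigroupRing.maximalIdeal_pow_eq ha (AddSubmonoid.subset_closure (by simp))
      (AddSubmonoid.subset_closure (by simp)) hmin (show a ≤ n + 1 by omega)]
    exact semigroupRing.colength_orderIdeal _
  · rw [eq_sub_iff_add_eq, Nat.choose_one_right]
    exact_mod_cast sum_range_mem_closure_add hdiv hr hqr (show a ≤ n + 1 by omega)

end ThreeGenerated

theorem mainTheorem4 (k : Type*) [Field k] (a d q r : ℕ) (ha : 0 < a) (hd : 2 ≤ d)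
    (hdiv : a = d * q + r) (hr : r < d) (hqr : (d : ℤ) - 2 ≤ (q : ℤ) + r)
    (hsymm : ¬ IsSymmetricSemigroup (AddSubmonoid.closure {a, a + 1, a + d})) :
    ∃ e₀ e₁ : ℤ,
      HasHilbertCoeffs (semigroupRing k (AddSubmonoid.closure {a, a + 1, a + d})) e₀ e₁ ∧
      (1 ≤ r → (r : ℤ) ≤ (d : ℤ) - 2 →
        (e₁ : ℚ) = ((a : ℚ) ^ 2 + d * (d - 2) * a - r * (d - 1) * (d - r)) / (2 * d)) ∧
      ((r : ℤ) = (d : ℤ) - 1 →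
        (e₁ : ℚ) = ((a : ℚ) ^ 2 + d * (d - 2) * a - ((d : ℚ) - 1) ^ 2) / (2 * d)) := by
  refine ⟨_, _, hasHilbertCoeffs_semigroupRing_three k ha hdiv hr (by omega), ?_⟩
  have hd0 : (d : ℚ) ≠ 0 := by exact_mod_cast (show d ≠ 0 by omega)
  have key : ((∑ i ∈ Finset.range a, coinCount d i : ℕ) : ℚ) =
      ((a : ℚ) ^ 2 + d * (d - 2) * a - r * (d - 1) * (d - r)) / (2 * d) := by
    have h := congrArg (Int.cast : ℤ → ℚ) (two_mul_sum_coinCount d q r hr.le)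
    rw [← hdiv] at h
    have ha' : (a : ℚ) = d * q + r := by exact_mod_cast hdiv
    rw [eq_div_iff (mul_ne_zero two_ne_zero hd0), ha']
    push_cast at h ⊢
    linear_combination (d : ℚ) * h
  rw [Int.cast_natCast, key]
  refine ⟨fun _ _ => rfl, fun hr1 => ?_⟩
  -- At `r = d - 1` the term `r * (d - 1) * (d - r)` becomes `(d - 1) ^ 2`.
  have hr' : (r : ℚ) = d - 1 := by exact_mod_cast hr1
  rw [hr']
  ring
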